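/- Let $m\ge 1$ and $n\ge 0$ be integers, and let $M$ be a non-empty smooth manifold of dimension $2m+1$ with a Sasakian structure $(\phi,\xi,\eta,g_M)$. That is, $\phi$ is a smooth $(1,1)$-tensor field, $\xi$ a smooth vector field, $\eta$ a smooth $1$-form and $g_M$ a Riemannian metric on $M$ such that $$\phi^2=-I+\eta\otimes\xi,\quad \phi\xi=0,\quad \eta\circ\phi=0,\quad \eta(\xi)=1,$$ $$g_M(\phi X,\phi Y)=g_M(X,Y)-\eta(X)\eta(Y),\quad \eta(X)=g_M(X,\xi),$$ and, writing $d\eta(X,Y)=X(\eta(Y))-Y(\eta(X))-\eta([X,Y])$ and $N_\phi(X,Y)=\phi^2[X,Y]+[\phi X,\phi Y]-\phi[\phi X,Y]-\phi[X,\phi Y]$, $$\tfrac12\,d\eta(X,Y)=g_M(X,\phi Y),\qquad N_\phi+d\eta\otimes\xi=0 .$$ (These are the normalizations for which $\nabla_X\xi=-\phi X$ and $(\nabla_X\phi)Y=g_M(X,Y)\xi-\eta(Y)X$.) Let $(N,g_N)$ be an $n$-dimensional Riemannian manifold and let $F:M\to N$ be an anti-invariant Riemannian submersion: $F$ is smooth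 and onto, its differential $F_*$ is surjective at every point and preserves the lengths of horizontal vectors, i.e. of vectors in $(\ker F_*)^\perp$, and $\phi(\ker F_*)\subseteq(\ker F_*)^\perp$. Suppose that at every point $$(\ker F_*)^\perp=\phi(\ker F_*)\oplus\langle\xi\rangle .$$ Then the horizontal distribution $(\ker F_*)^\perp$ is not integrable, i.e. there are smooth vector fields $X,Y\in\Gamma((\ker F_*)^\perp)$ with $[X,Y]\notin\Gamma((\ker F_*)^\perp)$. -/

import Mathlib

open scoped Manifold ContDiff

noncomputable section

namespace Sasaki

section OneManifold

variable {E : Type*} [NormedAddCommGroup E] [NormedSpace ℝ E]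
  {H : Type*} [TopologicalSpace H] (I : ModelWithCorners ℝ E H)
  {M : Type*} [TopologicalSpace M] [ChartedSpace H M]

/-- `X` is a smooth (globally defined) vector field. -/
def IsSmoothVectorField [IsManifold I ∞ M] (X : ∀ x : M, TangentSpace I x) : Prop :=
  ContMDiff I I.tangent ∞ (fun x ↦ (⟨x, X x⟩ : TangentBundle I M))

/-- The exterior derivative of a `1`-form `η`, evaluated on two vector fields, without the
factor `1/2`: `dη(X, Y) = X(η(Y)) - Y(η(X)) - η([X, Y])`. -/
def extDerivOneForm (η : ∀ x : M, TangentSpace I x →L[ℝ] ℝ)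
    (X Y : ∀ x : M, TangentSpace I x) (x : M) : ℝ :=
  mvfderiv I (fun y ↦ η y (Y y)) x (X x) - mvfderiv I (fun y ↦ η y (X y)) x (Y x)
    - η x (VectorField.mlieBracket I X Y x)

/-- The Nijenhuis tensor of a field of endomorphisms `φ`, evaluated on two vector fields:
`N(X, Y) = φ²[X, Y] + [φX, φY] - φ[φX, Y] - φ[X, φY]`. -/
def nijenhuis (φ : ∀ x : M, TangentSpace I x →L[ℝ] TangentSpace I x)
    (X Y : ∀ x : M, TangentSpace I x) (x : M) : TangentSpace I x :=
  φ x (φ x (VectorField.mlieBracket I X Y x))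
    + VectorField.mlieBracket I (fun y ↦ φ y (X y)) (fun y ↦ φ y (Y y)) x
    - φ x (VectorField.mlieBracket I (fun y ↦ φ y (X y)) Y x)
    - φ x (VectorField.mlieBracket I X (fun y ↦ φ y (Y y)) x)

variable (M) in
/-- An almost contact metric structure `(φ, ξ, η, g)` on `M`. -/
structure AlmostContactMetric [IsManifold I ∞ M] where
  /-- the tensor field of type `(1,1)` -/
  φ : ∀ x : M, TangentSpace I x →L[ℝ] TangentSpace I x
  /-- the characteristic vector field -/
  ξ : ∀ x : M, TangentSpace I x
  /-- the `1`-form -/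
  η : ∀ x : M, TangentSpace I x →L[ℝ] ℝ
  /-- the Riemannian metric -/
  g : Bundle.ContMDiffRiemannianMetric I ∞ E (fun x : M ↦ TangentSpace I x)
  smooth_φ : ContMDiff I (I.prod 𝓘(ℝ, E →L[ℝ] E)) ∞
    (fun x ↦ Bundle.TotalSpace.mk' (E →L[ℝ] E)
      (E := fun x : M ↦ TangentSpace I x →L[ℝ] TangentSpace I x) x (φ x))
  smooth_ξ : IsSmoothVectorField I ξ
  smooth_η : ContMDiff I (I.prod 𝓘(ℝ, E →L[ℝ] ℝ)) ∞
    (fun x ↦ Bundle.TotalSpace.mk' (E →L[ℝ] ℝ)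
      (E := fun x : M ↦ TangentSpace I x →L[ℝ] ℝ) x (η x))
  φ_φ : ∀ (x : M) (v : TangentSpace I x), φ x (φ x v) = -v + η x v • ξ x
  φ_ξ : ∀ x : M, φ x (ξ x) = 0
  η_φ : ∀ (x : M) (v : TangentSpace I x), η x (φ x v) = 0
  η_ξ : ∀ x : M, η x (ξ x) = 1
  g_φ_φ : ∀ (x : M) (v w : TangentSpace I x),
    g.inner x (φ x v) (φ x w) = g.inner x v w - η x v * η x w
  η_eq : ∀ (x : M) (v : TangentSpace I x), η x v = g.inner x v (ξ x)

/-- An almost contact metric structure is Sasakian if it is contact metric,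
`½ (X(η(Y)) - Y(η(X)) - η([X, Y])) = g(X, φY)`, and normal, `N + dη ⊗ ξ = 0`.
(These are the normalizations for which `∇_X ξ = -φX` and
`(∇_X φ)Y = g(X, Y)ξ - η(Y)X`.) -/
structure AlmostContactMetric.IsSasakian [IsManifold I ∞ M]
    (S : AlmostContactMetric I M) : Prop where
  contact : ∀ X Y : ∀ x : M, TangentSpace I x,
    IsSmoothVectorField I X → IsSmoothVectorField I Y → ∀ x : M,
      (1 / 2 : ℝ) * extDerivOneForm I S.η X Y x = S.g.inner x (X x) (S.φ x (Y x))
  normal : ∀ X Y : ∀ x : M, TangentSpace I x,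
    IsSmoothVectorField I X → IsSmoothVectorField I Y → ∀ x : M,
      nijenhuis I S.φ X Y x + extDerivOneForm I S.η X Y x • S.ξ x = 0

/-- A distribution `D` is integrable if its smooth sections are closed under the
Lie bracket: `[X, Y] ∈ Γ(D)` for all `X, Y ∈ Γ(D)`. -/
def IsIntegrable [IsManifold I ∞ M] (D : ∀ x : M, Submodule ℝ (TangentSpace I x)) : Prop :=
  ∀ X Y : ∀ x : M, TangentSpace I x,
    IsSmoothVectorField I X → IsSmoothVectorField I Y →
    (∀ x, X x ∈ D x) → (∀ x, Y x ∈ D x) →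
    ∀ x, VectorField.mlieBracket I X Y x ∈ D x

end OneManifold

section Submersion

variable {E : Type*} [NormedAddCommGroup E] [NormedSpace ℝ E]
  {H : Type*} [TopologicalSpace H] (I : ModelWithCorners ℝ E H)
  {M : Type*} [TopologicalSpace M] [ChartedSpace H M]
  {E' : Type*} [NormedAddCommGroup E'] [NormedSpace ℝ E']
  {H' : Type*} [TopologicalSpace H'] (J : ModelWithCorners ℝ E' H')
  {N : Type*} [TopologicalSpace N] [ChartedSpace H' N]

/-- The vertical space `ker F_*` at `x`. -/
def vertical (F : M → N) (x : M) : Submodule ℝ (TangentSpace I x) :=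
  LinearMap.ker (mfderiv I J F x).toLinearMap

/-- The horizontal space `(ker F_*)^⊥` at `x`, with respect to the metric `g`. -/
def horizontal [IsManifold I ∞ M]
    (g : Bundle.ContMDiffRiemannianMetric I ∞ E (fun x : M ↦ TangentSpace I x))
    (F : M → N) (x : M) : Submodule ℝ (TangentSpace I x) where
  carrier := {v | ∀ w ∈ vertical I J F x, g.inner x v w = 0}
  zero_mem' := fun w _ ↦ by simp
  add_mem' := fun ha hb w hw ↦ by
    rw [map_add, add_apply, ha w hw, hb w hw, add_zero]
  smul_mem' := fun c v hv w hw ↦ by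
    rw [map_smul, smul_apply, hv w hw, smul_zero]

/-- `F : (M, gM) → (N, gN)` is a Riemannian submersion: smooth, onto, of maximal rank, and its
differential preserves the lengths of horizontal vectors. -/
structure IsRiemannianSubmersion [IsManifold I ∞ M] [IsManifold J ∞ N]
    (gM : Bundle.ContMDiffRiemannianMetric I ∞ E (fun x : M ↦ TangentSpace I x))
    (gN : Bundle.ContMDiffRiemannianMetric J ∞ E' (fun y : N ↦ TangentSpace J y))
    (F : M → N) : Prop where
  smooth : ContMDiff I J ∞ F
  surjective : Function.Surjective F
  surjective_mfderiv : ∀ x : M, Function.Surjective (mfderiv I J F x)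
  isometric : ∀ (x : M), ∀ v ∈ horizontal I J gM F x,
    gN.inner (F x) (mfderiv I J F x v) (mfderiv I J F x v) = gM.inner x v v

/-- The image `φ (ker F_*)` at `x`. -/
def phiVertical [IsManifold I ∞ M] (S : AlmostContactMetric I M) (F : M → N) (x : M) :
    Submodule ℝ (TangentSpace I x) :=
  (vertical I J F x).map (S.φ x).toLinearMap

/-- `F` is an anti-invariant Riemannian submersion: a Riemannian submersion with
`φ (ker F_*) ⊆ (ker F_*)^⊥`. -/
structure IsAntiInvariantSubmersion [IsManifold I ∞ M] [IsManifold J ∞ N]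
    (S : AlmostContactMetric I M)
    (gN : Bundle.ContMDiffRiemannianMetric J ∞ E' (fun y : N ↦ TangentSpace J y))
    (F : M → N) : Prop extends IsRiemannianSubmersion I J S.g gN F where
  antiInvariant : ∀ x : M, phiVertical I J S F x ≤ horizontal I J S.g F x

end Submersion

end Sasaki

end

/-! Suppose the horizontal distribution is integrable. The vertical space at a point is nonzero:
otherwise the whole tangent space would be the line of `ξ`, while `2m + 1 ≥ 3`. Extend a nonzero
vertical `w` to a global vertical field `W`; then `ξ` and `φW` are horizontal and orthogonal.

Since `F^*g_N` is invariant along vertical fields (`inner_mfderiv_mlieBracket_add_eq_zero`),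
differentiating `F^*g_N(ξ, φW) = 0` along `W` gives `g([W, ξ], φW) + η([W, φW]) = 0`. The contact
condition makes the second term `2 g(W, W)` (`η_mlieBracket_φ`). Normality gives `φ²[ξ, W] = φ[ξ,
φW]` (`φ_mlieBracket_ξ`), so the first term equals `g([ξ, φW], W)` up to sign, which vanishes when
`[ξ, φW]` is horizontal. Hence `g(w, w) = 0`, a contradiction. No connection is needed. -/

open scoped Topology
open VectorField

/-! ### Calculus in normed spaces: brackets and the kernel of a derivative. -/

section NormedSpace

variable {E : Type*} [NormedAddCommGroup E] [NormedSpace ℝ E]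
  {E' : Type*} [NormedAddCommGroup E'] [NormedSpace ℝ E']

/-- If `dG(W) = 0`, then `dG [W, X]` is the derivative of `dG(X)` in the direction `W`. -/
theorem fderiv_fderiv_apply_of_fderiv_apply_eq_zero {G : E → E'} {W X : E → E} {p : E}
    (hG : ContDiffAt ℝ 2 G p) (hW : DifferentiableAt ℝ W p) (hX : DifferentiableAt ℝ X p)
    (h0 : ∀ᶠ u in 𝓝 p, fderiv ℝ G u (W u) = 0) :
    fderiv ℝ (fun u ↦ fderiv ℝ G u (X u)) p (W p) = fderiv ℝ G p (lieBracket ℝ W X p) := by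
  have hG' : DifferentiableAt ℝ (fderiv ℝ G) p :=
    (hG.fderiv_right (m := 1) (by norm_num)).differentiableAt one_ne_zero
  -- The derivative of `dG(X)` along `W` is `D²G(W, X) + dG(DX·W)`, and that of `dG(W) = 0` along
  -- `X` is `D²G(X, W) + dG(DW·X)`. Subtracting cancels the second derivatives.
  have hsymm : fderiv ℝ (fderiv ℝ G) p (W p) (X p) = fderiv ℝ (fderiv ℝ G) p (X p) (W p) :=
    (hG.isSymmSndFDerivAt (by simp)).eq _ _
  have hzero : fderiv ℝ (fun u ↦ fderiv ℝ G u (W u)) p (X p) = 0 := by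
    rw [Filter.EventuallyEq.fderiv_eq (f := fun _ ↦ (0 : E')) h0]
    simp
  rw [fderiv_clm_apply hG' hW] at hzero
  rw [fderiv_clm_apply hG' hX]
  simp only [add_apply, ContinuousLinearMap.comp_apply, ContinuousLinearMap.flip_apply] at hzero ⊢
  rw [lieBracket_eq, map_sub, hsymm, ← sub_eq_zero]
  rw [← hzero]
  abel

/-- The pull-back of a field of bilinear forms by `G` is invariant along `ker dG`. -/
theorem pullback_bilin_lieBracket_add_eq_zero {G : E → E'} {W X Y : E → E} {p : E}
    {B : E' → E' →L[ℝ] E' →L[ℝ] ℝ} (hB : ContDiffAt ℝ 1 B (G p))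
    (hG : ContDiffAt ℝ 2 G p) (hW : DifferentiableAt ℝ W p) (hX : DifferentiableAt ℝ X p)
    (hY : DifferentiableAt ℝ Y p) (h0 : ∀ᶠ u in 𝓝 p, fderiv ℝ G u (W u) = 0)
    (hXY : ∀ᶠ u in 𝓝 p, B (G u) (fderiv ℝ G u (X u)) (fderiv ℝ G u (Y u)) = 0) :
    B (G p) (fderiv ℝ G p (lieBracket ℝ W X p)) (fderiv ℝ G p (Y p)) +
      B (G p) (fderiv ℝ G p (X p)) (fderiv ℝ G p (lieBracket ℝ W Y p)) = 0 := by
  have hG' : DifferentiableAt ℝ (fderiv ℝ G) p :=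
    (hG.fderiv_right (m := 1) (by norm_num)).differentiableAt one_ne_zero
  have hG1 : DifferentiableAt ℝ G p := hG.differentiableAt two_ne_zero
  have hBG : DifferentiableAt ℝ (fun u ↦ B (G u)) p :=
    (hB.comp p (hG.of_le one_le_two)).differentiableAt one_ne_zero
  -- The coefficients `B ∘ G` are stationary along `W`, so the product rule leaves only the two
  -- bracket terms.
  have hBW : fderiv ℝ (fun u ↦ B (G u)) p (W p) = 0 := by
    have := ((hB.differentiableAt one_ne_zero).hasFDerivAt.comp p hG1.hasFDerivAt).fderiv
    simp only [Function.comp_def] at this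
    rw [this, ContinuousLinearMap.comp_apply, h0.self_of_nhds, map_zero]
  have hGX : DifferentiableAt ℝ (fun u ↦ fderiv ℝ G u (X u)) p := hG'.clm_apply hX
  have hGY : DifferentiableAt ℝ (fun u ↦ fderiv ℝ G u (Y u)) p := hG'.clm_apply hY
  have hzero : fderiv ℝ (fun u ↦ B (G u) (fderiv ℝ G u (X u)) (fderiv ℝ G u (Y u))) p (W p)
      = 0 := by
    rw [Filter.EventuallyEq.fderiv_eq (f := fun _ ↦ (0 : ℝ)) hXY]
    simp
  rw [fderiv_clm_apply (hBG.clm_apply hGX) hGY, fderiv_clm_apply hBG hGX] at hzero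
  simp only [add_apply, ContinuousLinearMap.comp_apply, ContinuousLinearMap.flip_apply, hBW,
    fderiv_fderiv_apply_of_fderiv_apply_eq_zero hG hW hX h0,
    fderiv_fderiv_apply_of_fderiv_apply_eq_zero hG hW hY h0, zero_apply, add_zero] at hzero
  rw [← hzero, add_comm]

/-- A vector in the kernel of a surjective derivative extends to a smooth section of the
kernels. -/
theorem exists_contDiffOn_fderiv_apply_eq_zero [CompleteSpace E] [FiniteDimensional ℝ E']
    {G : E → E'} {U : Set E}
    {p : E} (hU : IsOpen U) (hp : p ∈ U) (hG : ContDiffOn ℝ ∞ G U)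
    (hs : Function.Surjective (fderiv ℝ G p)) {w : E} (hw : fderiv ℝ G p w = 0) :
    ∃ W : E → E, ∃ V ⊆ U, IsOpen V ∧ p ∈ V ∧ ContDiffOn ℝ ∞ W V ∧ W p = w ∧
      ∀ u ∈ V, fderiv ℝ G u (W u) = 0 := by
  obtain ⟨R, hR⟩ := (fderiv ℝ G p).exists_rightInverse_of_surjective
    (LinearMap.range_eq_top.2 hs)
  have hG' : ContDiffOn ℝ ∞ (fderiv ℝ G) U := hG.fderiv_of_isOpen hU (by simp)
  have hGR : ContDiffOn ℝ ∞ (fun u ↦ (fderiv ℝ G u).comp R) U := hG'.clm_comp contDiffOn_const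
  set e : E' ≃L[ℝ] E' := ContinuousLinearEquiv.refl ℝ E'
  set V := U ∩ (fun u ↦ (fderiv ℝ G u).comp R) ⁻¹' Set.range ((↑) : (E' ≃L[ℝ] E') → E' →L[ℝ] E')
  have hV : IsOpen V := hGR.continuousOn.isOpen_inter_preimage hU
    ContinuousLinearEquiv.isOpen
  -- `R (dG_u R)⁻¹ dG_u` is a projection with kernel `ker dG_u`; subtracting its value at `w` leaves
  -- a kernel vector, equal to `w` at `p`. `V` is the open set where `dG_u R` is invertible.
  refine ⟨fun u ↦ w - R (((fderiv ℝ G u).comp R).inverse (fderiv ℝ G u w)), V,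
    Set.inter_subset_left, hV, ⟨hp, e, ?_⟩, ?_, ?_, ?_⟩
  · simp [hR, e]
  · intro u hu
    have hinv : ContDiffAt ℝ ∞ (fun u ↦ ((fderiv ℝ G u).comp R).inverse) u := by
      obtain ⟨f, hf⟩ := hu.2
      refine ContDiffAt.comp u (g := ContinuousLinearMap.inverse) ?_
        (hGR.contDiffAt (hU.mem_nhds hu.1))
      rw [show (fderiv ℝ G u).comp R = f from hf.symm]
      exact contDiffAt_map_inverse f
    refine (contDiffAt_const.sub (R.contDiff.contDiffAt.comp u (hinv.clm_apply
      ((hG'.contDiffAt (hU.mem_nhds hu.1)).clm_apply contDiffAt_const)))).contDiffWithinAt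
  · simp [hw]
  · rintro u ⟨-, f, hf⟩
    have : ∀ v, fderiv ℝ G u (R v) = f v := fun v ↦ by
      simpa using (DFunLike.congr_fun hf v).symm
    rw [map_sub, this, show (fderiv ℝ G u).comp R = f from hf.symm]
    simp

end NormedSpace

/-! ### Transfer to manifolds through charts. -/

section Chart

variable {E : Type*} [NormedAddCommGroup E] [NormedSpace ℝ E]
  {M : Type*} [TopologicalSpace M] [ChartedSpace E M] [IsManifold 𝓘(ℝ, E) ∞ M]
  {E' : Type*} [NormedAddCommGroup E'] [NormedSpace ℝ E']
  {N : Type*} [TopologicalSpace N] [ChartedSpace E' N] [IsManifold 𝓘(ℝ, E') ∞ N]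

/-- The expression of `X` in the preferred chart at `p`. -/
noncomputable def chartVectorField (p : M) (X : ∀ x : M, TangentSpace 𝓘(ℝ, E) x) : E → E :=
  mpullbackWithin 𝓘(ℝ, E) 𝓘(ℝ, E) (extChartAt 𝓘(ℝ, E) p).symm X (Set.range 𝓘(ℝ, E))

theorem inverse_mfderivWithin_extChartAt_symm {p x : M}
    (hx : x ∈ (extChartAt 𝓘(ℝ, E) p).source) :
    (mfderivWithin 𝓘(ℝ, E) 𝓘(ℝ, E) (extChartAt 𝓘(ℝ, E) p).symm (Set.range 𝓘(ℝ, E))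
      (extChartAt 𝓘(ℝ, E) p x)).inverse = mfderiv 𝓘(ℝ, E) 𝓘(ℝ, E) (extChartAt 𝓘(ℝ, E) p) x := by
  have : IsManifold 𝓘(ℝ, E) 1 M := IsManifold.of_le (n := ∞) (by simp)
  exact ContinuousLinearMap.inverse_eq
    (mfderivWithin_extChartAt_symm_comp_mfderiv_extChartAt' hx)
    (mfderiv_extChartAt_comp_mfderivWithin_extChartAt_symm' hx)

theorem chartVectorField_extChartAt (p : M) (X : ∀ x : M, TangentSpace 𝓘(ℝ, E) x) {x : M}
    (hx : x ∈ (extChartAt 𝓘(ℝ, E) p).source) :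
    chartVectorField p X (extChartAt 𝓘(ℝ, E) p x) =
      mfderiv 𝓘(ℝ, E) 𝓘(ℝ, E) (extChartAt 𝓘(ℝ, E) p) x (X x) := by
  have h := inverse_mfderivWithin_extChartAt_symm hx
  have hx' := (extChartAt 𝓘(ℝ, E) p).left_inv hx
  rw [chartVectorField, mpullbackWithin_apply]
  rw [← h]
  rw [hx']

theorem differentiableAt_chartVectorField [CompleteSpace E] (p : M)
    {X : ∀ x : M, TangentSpace 𝓘(ℝ, E) x} (hX : Sasaki.IsSmoothVectorField 𝓘(ℝ, E) X) :
    DifferentiableAt ℝ (chartVectorField p X) (extChartAt 𝓘(ℝ, E) p p) := by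
  have : IsManifold 𝓘(ℝ, E) 2 M := IsManifold.of_le (n := ∞) (by decide)
  have := MDifferentiableWithinAt.differentiableWithinAt_mpullbackWithin_vectorField
    (s := Set.univ) (x := p) (ContMDiff.mdifferentiable hX (by decide) p).mdifferentiableWithinAt
  rw [← differentiableWithinAt_univ]
  simpa [chartVectorField] using this

/-- The bracket at `p` is defined by pulling back through the chart at `p` itself, and the
derivative of that chart undoes the pull-back. -/
theorem mfderiv_extChartAt_mlieBracket (p : M) (X Y : ∀ x : M, TangentSpace 𝓘(ℝ, E) x) :
    mfderiv 𝓘(ℝ, E) 𝓘(ℝ, E) (extChartAt 𝓘(ℝ, E) p) p (mlieBracket 𝓘(ℝ, E) X Y p) =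
      lieBracket ℝ (chartVectorField p X) (chartVectorField p Y) (extChartAt 𝓘(ℝ, E) p p) := by
  have : IsManifold 𝓘(ℝ, E) 1 M := IsManifold.of_le (n := ∞) (by simp)
  refine ((isInvertible_mfderiv_extChartAt (mem_extChartAt_source p)).self_apply_inverse _).trans ?_
  simp only [Set.preimage_univ, modelWithCornersSelf_coe, Set.range_id, Set.inter_univ]
  rw [← lieBracketWithin_univ]
  simp only [chartVectorField, modelWithCornersSelf_coe, Set.range_id]
  rfl

/-- The chain rule, stated at all `x` near `p`: the hypotheses that get differentiated must hold on
a neighbourhood. -/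
theorem fderiv_writtenInExtChartAt {F : M → N} (hF : ContMDiff 𝓘(ℝ, E) 𝓘(ℝ, E') ∞ F) {p x : M}
    (hx : x ∈ (extChartAt 𝓘(ℝ, E) p).source) (hFx : F x ∈ (extChartAt 𝓘(ℝ, E') (F p)).source)
    (v : TangentSpace 𝓘(ℝ, E) x) :
    fderiv ℝ (writtenInExtChartAt 𝓘(ℝ, E) 𝓘(ℝ, E') p F) (extChartAt 𝓘(ℝ, E) p x)
        (mfderiv 𝓘(ℝ, E) 𝓘(ℝ, E) (extChartAt 𝓘(ℝ, E) p) x v) =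
      mfderiv 𝓘(ℝ, E') 𝓘(ℝ, E') (extChartAt 𝓘(ℝ, E') (F p)) (F x)
        (mfderiv 𝓘(ℝ, E) 𝓘(ℝ, E') F x v) := by
  have : IsManifold 𝓘(ℝ, E) 1 M := IsManifold.of_le (n := ∞) (by simp)
  have : IsManifold 𝓘(ℝ, E') 1 N := IsManifold.of_le (n := ∞) (by simp)
  have hxt := (extChartAt 𝓘(ℝ, E) p).map_source hx
  have hinv := (extChartAt 𝓘(ℝ, E) p).left_inv hx
  have hsymm := mdifferentiableWithinAt_extChartAt_symm hxt
  have hid := DFunLike.congr_fun (mfderivWithin_extChartAt_symm_comp_mfderiv_extChartAt' hx) v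
  simp only [modelWithCornersSelf_coe, Set.range_id] at hsymm hid
  rw [mdifferentiableWithinAt_univ] at hsymm
  rw [mfderivWithin_univ] at hid
  have hψ : MDifferentiableAt 𝓘(ℝ, E') 𝓘(ℝ, E') (extChartAt 𝓘(ℝ, E') (F p)) (F x) :=
    mdifferentiableAt_extChartAt (by simpa using hFx)
  have hFd : MDifferentiableAt 𝓘(ℝ, E) 𝓘(ℝ, E') F x := hF.mdifferentiable (by decide) x
  have h1 := mfderiv_comp_apply_of_eq (x := extChartAt 𝓘(ℝ, E) p x) (y := x)
    (g := extChartAt 𝓘(ℝ, E') (F p) ∘ F) (hψ.comp x hFd) hsymm hinv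
    (mfderiv 𝓘(ℝ, E) 𝓘(ℝ, E) (extChartAt 𝓘(ℝ, E) p) x v)
  rw [← mfderiv_eq_fderiv]
  refine h1.trans ?_
  have h2 : mfderiv 𝓘(ℝ, E) 𝓘(ℝ, E) (extChartAt 𝓘(ℝ, E) p).symm (extChartAt 𝓘(ℝ, E) p x)
      (mfderiv 𝓘(ℝ, E) 𝓘(ℝ, E) (extChartAt 𝓘(ℝ, E) p) x v) = v := hid
  exact (congrArg (mfderiv 𝓘(ℝ, E) 𝓘(ℝ, E') (extChartAt 𝓘(ℝ, E') (F p) ∘ F) x) h2).trans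
    (mfderiv_comp_apply x hψ hFd v)

theorem contDiffOn_writtenInExtChartAt {F : M → N} (hF : ContMDiff 𝓘(ℝ, E) 𝓘(ℝ, E') ∞ F)
    (p : M) :
    ∃ U : Set E, IsOpen U ∧ extChartAt 𝓘(ℝ, E) p p ∈ U ∧ U ⊆ (extChartAt 𝓘(ℝ, E) p).target ∧
      (∀ u ∈ U, F ((extChartAt 𝓘(ℝ, E) p).symm u) ∈ (extChartAt 𝓘(ℝ, E') (F p)).source) ∧
      ContDiffOn ℝ ∞ (writtenInExtChartAt 𝓘(ℝ, E) 𝓘(ℝ, E') p F) U := by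
  refine ⟨(extChartAt 𝓘(ℝ, E) p).target ∩ (extChartAt 𝓘(ℝ, E) p).symm ⁻¹'
    (F ⁻¹' (extChartAt 𝓘(ℝ, E') (F p)).source), ?_, ?_, Set.inter_subset_left, fun u hu ↦ hu.2, ?_⟩
  · exact (continuousOn_extChartAt_symm p).isOpen_inter_preimage (isOpen_extChartAt_target p)
      ((isOpen_extChartAt_source (F p)).preimage hF.continuous)
  · refine ⟨mem_extChartAt_target p, ?_⟩
    simp
  · rw [← contMDiffOn_iff_contDiffOn]
    refine (contMDiffOn_extChartAt (x := F p) (n := ∞)).comp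
      (hF.comp_contMDiffOn ((contMDiffOn_extChartAt_symm p).mono Set.inter_subset_left)) ?_
    intro u hu
    simpa using hu.2

/-- A Riemannian metric expressed in a chart. -/
theorem exists_metric_in_chart (g : Bundle.ContMDiffRiemannianMetric 𝓘(ℝ, E') ∞ E'
      (fun y : N ↦ TangentSpace 𝓘(ℝ, E') y)) (q : N) :
    ∃ B : E' → E' →L[ℝ] E' →L[ℝ] ℝ, ContDiffAt ℝ 1 B (extChartAt 𝓘(ℝ, E') q q) ∧
      ∀ y ∈ (extChartAt 𝓘(ℝ, E') q).source, ∀ a b : TangentSpace 𝓘(ℝ, E') y,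
        B (extChartAt 𝓘(ℝ, E') q y)
          (mfderiv 𝓘(ℝ, E') 𝓘(ℝ, E') (extChartAt 𝓘(ℝ, E') q) y a)
          (mfderiv 𝓘(ℝ, E') 𝓘(ℝ, E') (extChartAt 𝓘(ℝ, E') q) y b) = g.inner y a b := by
  refine ⟨fun v ↦ ContinuousLinearMap.inCoordinates E' (TangentSpace 𝓘(ℝ, E')) (E' →L[ℝ] ℝ)
    (fun y : N ↦ TangentSpace 𝓘(ℝ, E') y →L[ℝ] ℝ) q ((extChartAt 𝓘(ℝ, E') q).symm v)
    q ((extChartAt 𝓘(ℝ, E') q).symm v) (g.inner ((extChartAt 𝓘(ℝ, E') q).symm v)), ?_, ?_⟩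
  · have h := ((contMDiffAt_hom_bundle _).1 (g.contMDiff q)).2
    have h2 : ContMDiffAt 𝓘(ℝ, E') 𝓘(ℝ, E') ∞ (extChartAt 𝓘(ℝ, E') q).symm
        (extChartAt 𝓘(ℝ, E') q q) :=
      (contMDiffOn_extChartAt_symm q).contMDiffAt (extChartAt_target_mem_nhds q)
    have h3 := ContMDiffAt.comp_of_eq h h2 (by simp)
    exact (contMDiffAt_iff_contDiffAt.1 h3).of_le (by simp)
  · intro y hy a b
    have hinv := (extChartAt 𝓘(ℝ, E') q).left_inv hy
    have hy' : y ∈ (chartAt E' q).source := by simpa using hy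
    have hb : y ∈ (trivializationAt E' (TangentSpace 𝓘(ℝ, E')) q).baseSet := by simpa using hy'
    set β : N → E' →L[ℝ] E' →L[ℝ] ℝ := fun y ↦
      ContinuousLinearMap.inCoordinates E' (TangentSpace 𝓘(ℝ, E')) (E' →L[ℝ] ℝ)
        (fun y : N ↦ TangentSpace 𝓘(ℝ, E') y →L[ℝ] ℝ) q y q y (g.inner y)
    have hsymm : ∀ c : TangentSpace 𝓘(ℝ, E') y,
        (trivializationAt E' (TangentSpace 𝓘(ℝ, E')) q).symm y
          (mfderiv 𝓘(ℝ, E') 𝓘(ℝ, E') (extChartAt 𝓘(ℝ, E') q) y c) = c := by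
      intro c
      rw [← TangentBundle.continuousLinearMapAt_trivializationAt hy']
      exact (Bundle.Trivialization.symmL_apply (R := ℝ) _ hb _).symm.trans <|
        (trivializationAt E' (TangentSpace 𝓘(ℝ, E')) q).symmL_continuousLinearMapAt (R := ℝ) hb c
    change β ((extChartAt 𝓘(ℝ, E') q).symm (extChartAt 𝓘(ℝ, E') q y)) _ _ = _
    rw [hinv]
    refine (inCoordinates_apply_eq₂ hb hb (Set.mem_univ _)).trans ?_
    rw [hsymm a, hsymm b]
    simp

/-- The pull-back of a metric by `F` is invariant along the fibres of `F`. -/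
theorem inner_mfderiv_mlieBracket_add_eq_zero [CompleteSpace E]
    (g : Bundle.ContMDiffRiemannianMetric 𝓘(ℝ, E') ∞ E'
      (fun y : N ↦ TangentSpace 𝓘(ℝ, E') y)) {F : M → N}
    (hF : ContMDiff 𝓘(ℝ, E) 𝓘(ℝ, E') ∞ F) {W X Y : ∀ x : M, TangentSpace 𝓘(ℝ, E) x}
    (hW : Sasaki.IsSmoothVectorField 𝓘(ℝ, E) W) (hX : Sasaki.IsSmoothVectorField 𝓘(ℝ, E) X)
    (hY : Sasaki.IsSmoothVectorField 𝓘(ℝ, E) Y)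
    (hFW : ∀ x, mfderiv 𝓘(ℝ, E) 𝓘(ℝ, E') F x (W x) = 0)
    (hXY : ∀ x, g.inner (F x) (mfderiv 𝓘(ℝ, E) 𝓘(ℝ, E') F x (X x))
      (mfderiv 𝓘(ℝ, E) 𝓘(ℝ, E') F x (Y x)) = 0) (p : M) :
    g.inner (F p) (mfderiv 𝓘(ℝ, E) 𝓘(ℝ, E') F p (mlieBracket 𝓘(ℝ, E) W X p))
        (mfderiv 𝓘(ℝ, E) 𝓘(ℝ, E') F p (Y p)) +
      g.inner (F p) (mfderiv 𝓘(ℝ, E) 𝓘(ℝ, E') F p (X p))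
        (mfderiv 𝓘(ℝ, E) 𝓘(ℝ, E') F p (mlieBracket 𝓘(ℝ, E) W Y p)) = 0 := by
  obtain ⟨U, hU, hpU, hUt, hUF, hG⟩ := contDiffOn_writtenInExtChartAt hF p
  obtain ⟨B, hB, hBg⟩ := exists_metric_in_chart g (F p)
  set φ := extChartAt 𝓘(ℝ, E) p
  set G := writtenInExtChartAt 𝓘(ℝ, E) 𝓘(ℝ, E') p F with hGdef
  have hGφ : ∀ u, G u = extChartAt 𝓘(ℝ, E') (F p) (F (φ.symm u)) := fun u ↦ rfl
  have key : ∀ u ∈ U, ∀ Z : ∀ x : M, TangentSpace 𝓘(ℝ, E) x,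
      fderiv ℝ G u (chartVectorField p Z u) =
        mfderiv 𝓘(ℝ, E') 𝓘(ℝ, E') (extChartAt 𝓘(ℝ, E') (F p)) (F (φ.symm u))
          (mfderiv 𝓘(ℝ, E) 𝓘(ℝ, E') F (φ.symm u) (Z (φ.symm u))) := by
    intro u hu Z
    have h1 := φ.map_target (hUt hu)
    have h2 := fderiv_writtenInExtChartAt hF h1 (hUF u hu) (Z (φ.symm u))
    rw [← chartVectorField_extChartAt p Z h1] at h2
    rwa [show extChartAt 𝓘(ℝ, E) p (φ.symm u) = u from φ.right_inv (hUt hu)] at h2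
  have hps : p ∈ φ.source := mem_extChartAt_source p
  have hFps : F p ∈ (extChartAt 𝓘(ℝ, E') (F p)).source := mem_extChartAt_source (F p)
  have hGp : G (φ p) = extChartAt 𝓘(ℝ, E') (F p) (F p) := by rw [hGφ, φ.left_inv hps]
  have h := pullback_bilin_lieBracket_add_eq_zero (p := φ p) (G := G) (B := B) (by rwa [hGp])
    ((hG.contDiffAt (hU.mem_nhds hpU)).of_le (by decide))
    (differentiableAt_chartVectorField p hW) (differentiableAt_chartVectorField p hX)
    (differentiableAt_chartVectorField p hY)
    (by
      filter_upwards [hU.mem_nhds hpU] with u hu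
      rw [key u hu W, hFW]
      exact map_zero _)
    (by
      filter_upwards [hU.mem_nhds hpU] with u hu
      rw [key u hu X, key u hu Y, hGφ, hBg _ (hUF u hu), hXY])
  rw [← mfderiv_extChartAt_mlieBracket, ← mfderiv_extChartAt_mlieBracket,
    chartVectorField_extChartAt p X hps, chartVectorField_extChartAt p Y hps,
    hGdef, fderiv_writtenInExtChartAt hF hps hFps, fderiv_writtenInExtChartAt hF hps hFps,
    fderiv_writtenInExtChartAt hF hps hFps, fderiv_writtenInExtChartAt hF hps hFps, ← hGdef, hGp,
    hBg _ hFps, hBg _ hFps] at h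
  exact h

/-- A vertical vector of a submersion extends to a global smooth vertical vector field. -/
theorem exists_smooth_vertical_vectorField [FiniteDimensional ℝ E] [FiniteDimensional ℝ E']
    [T2Space M] {F : M → N}
    (hF : ContMDiff 𝓘(ℝ, E) 𝓘(ℝ, E') ∞ F) {p : M}
    (hs : Function.Surjective (mfderiv 𝓘(ℝ, E) 𝓘(ℝ, E') F p)) {w : TangentSpace 𝓘(ℝ, E) p}
    (hw : mfderiv 𝓘(ℝ, E) 𝓘(ℝ, E') F p w = 0) :
    ∃ W : ∀ x : M, TangentSpace 𝓘(ℝ, E) x, Sasaki.IsSmoothVectorField 𝓘(ℝ, E) W ∧ W p = w ∧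
      ∀ x, mfderiv 𝓘(ℝ, E) 𝓘(ℝ, E') F x (W x) = 0 := by
  obtain ⟨U, hU, hpU, hUt, hUF, hG⟩ := contDiffOn_writtenInExtChartAt hF p
  have : IsManifold 𝓘(ℝ, E) 1 M := IsManifold.of_le (n := ∞) (by simp)
  set φ := extChartAt 𝓘(ℝ, E) p with hφ
  have hps : p ∈ φ.source := mem_extChartAt_source p
  have hFps : F p ∈ (extChartAt 𝓘(ℝ, E') (F p)).source := mem_extChartAt_source (F p)
  have hder := fun v ↦ fderiv_writtenInExtChartAt hF hps hFps v
  have hGs : Function.Surjective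
      (fderiv ℝ (writtenInExtChartAt 𝓘(ℝ, E) 𝓘(ℝ, E') p F) (φ p)) := by
    intro z
    obtain ⟨y, hy⟩ := (isInvertible_mfderiv_extChartAt hFps).bijective.2 z
    obtain ⟨v, rfl⟩ := hs y
    exact ⟨_, (hder v).trans hy⟩
  obtain ⟨W', V, hVU, hV, hpV, hW', hW'p, hW'0⟩ := exists_contDiffOn_fderiv_apply_eq_zero hU hpU hG
    hGs (w := mfderiv 𝓘(ℝ, E) 𝓘(ℝ, E) φ p w) (by rw [hder, hw]; exact map_zero _)
  set O := φ.source ∩ φ ⁻¹' V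
  have hO : IsOpen O := (continuousOn_extChartAt p).isOpen_inter_preimage
    (isOpen_extChartAt_source p) hV
  -- Verticality survives multiplication by a function, so a bump function supported in `O` makes
  -- the local field global.
  obtain ⟨χ, -, hχ⟩ := (SmoothBumpFunction.nhds_basis_tsupport (I := 𝓘(ℝ, E)) p).mem_iff.1
    (hO.mem_nhds ⟨hps, hpV⟩)
  refine ⟨(χ : M → ℝ) • mpullback 𝓘(ℝ, E) 𝓘(ℝ, E) φ W', ?_, ?_, ?_⟩
  · refine ContMDiffOn.smul_section_of_tsupport χ.contMDiff.contMDiffOn hO hχ ?_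
    intro x hx
    refine (ContMDiffAt.mpullback_vectorField_preimage (n := ∞) (m := ∞) ?_ ?_
      (isInvertible_mfderiv_extChartAt hx.1) (by simp)).contMDiffWithinAt
    · exact contMDiffAt_vectorSpace_iff_contDiffAt.2 (hW'.contDiffAt (hV.mem_nhds hx.2))
    · exact contMDiffAt_extChartAt' (by simpa [hφ] using hx.1)
  · rw [Pi.smul_apply', χ.eq_one, one_smul]
    exact (isInvertible_mfderiv_extChartAt hps).inverse_apply_eq.2 hW'p
  · intro x
    by_cases hx : x ∈ O
    · have hFx : F x ∈ (extChartAt 𝓘(ℝ, E') (F p)).source := by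
        simpa only [Set.mem_preimage, φ.left_inv hx.1] using hUF _ (hVU hx.2)
      have hz : mfderiv 𝓘(ℝ, E) 𝓘(ℝ, E) φ x (mpullback 𝓘(ℝ, E) 𝓘(ℝ, E) φ W' x) = W' (φ x) :=
        (isInvertible_mfderiv_extChartAt hx.1).self_apply_inverse _
      have h := fderiv_writtenInExtChartAt hF hx.1 hFx (mpullback 𝓘(ℝ, E) 𝓘(ℝ, E) φ W' x)
      rw [← hφ, hz, hW'0 _ hx.2] at h
      rw [Pi.smul_apply', map_smul,
        (isInvertible_mfderiv_extChartAt hFx).injective (h.symm.trans (map_zero _).symm),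
        smul_zero]
    · rw [Pi.smul_apply', image_eq_zero_of_notMem_tsupport fun h ↦ hx (hχ h), zero_smul, map_zero]

end Chart

/-! ### Sasakian identities and Riemannian submersions. -/

namespace Sasaki

section AlmostContact

variable {E : Type*} [NormedAddCommGroup E] [NormedSpace ℝ E]
  {H : Type*} [TopologicalSpace H] {I : ModelWithCorners ℝ E H}
  {M : Type*} [TopologicalSpace M] [ChartedSpace H M] [IsManifold I ∞ M]
  (S : AlmostContactMetric I M)

theorem AlmostContactMetric.inner_φ_right (x : M) (v w : TangentSpace I x) :
    S.g.inner x v (S.φ x w) = -S.g.inner x (S.φ x v) w := by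
  have h := S.g_φ_φ x v (S.φ x w)
  rw [S.φ_φ, S.η_φ, map_add, map_neg, map_smul, ← S.η_eq, S.η_φ] at h
  simp only [smul_eq_mul, mul_zero, add_zero, sub_zero] at h
  exact h.symm

theorem AlmostContactMetric.isSmoothVectorField_φ {X : ∀ x : M, TangentSpace I x}
    (hX : IsSmoothVectorField I X) : IsSmoothVectorField I (fun x ↦ S.φ x (X x)) :=
  ContMDiff.clm_bundle_apply (F₁ := E) (F₂ := E) (E₁ := fun x : M ↦ TangentSpace I x)
    (E₂ := fun x : M ↦ TangentSpace I x) S.smooth_φ hX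

variable {S}

theorem AlmostContactMetric.IsSasakian.extDerivOneForm_eq (hS : S.IsSasakian)
    {X Y : ∀ x : M, TangentSpace I x}
    (hX : IsSmoothVectorField I X) (hY : IsSmoothVectorField I Y) (x : M) :
    extDerivOneForm I S.η X Y x = 2 * S.g.inner x (X x) (S.φ x (Y x)) := by
  linarith [hS.contact X Y hX hY x]

/-- The Lie derivative of `φ` along `ξ` takes values in `⟨ξ⟩`. -/
theorem AlmostContactMetric.IsSasakian.φ_mlieBracket_ξ (hS : S.IsSasakian)
    {X : ∀ x : M, TangentSpace I x} (hX : IsSmoothVectorField I X) (x : M) :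
    S.φ x (S.φ x (mlieBracket I S.ξ X x)) =
      S.φ x (mlieBracket I S.ξ (fun y ↦ S.φ y (X y)) x) := by
  -- With `ξ` as first argument, `φξ = 0` kills two terms of the Nijenhuis tensor and also `dη(ξ,
  -- X)`.
  have h := hS.normal S.ξ X S.smooth_ξ hX x
  have hd : extDerivOneForm I S.η S.ξ X x = 0 := by
    rw [hS.extDerivOneForm_eq S.smooth_ξ hX, S.inner_φ_right, S.φ_ξ]
    simp
  have h0 : (fun y ↦ S.φ y (S.ξ y)) = 0 := funext fun y ↦ S.φ_ξ y
  rw [hd, zero_smul, add_zero, nijenhuis, h0, mlieBracket_zero_left, mlieBracket_zero_left] at h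
  simp only [Pi.zero_apply, map_zero, add_zero, sub_zero] at h
  exact sub_eq_zero.1 h

/-- As `η` vanishes on `X` and `φX`, `dη(X, φX) = -η([X, φX])`, while the contact condition gives `2
g(X, φ²X) = -2 g(X, X)`. -/
theorem AlmostContactMetric.IsSasakian.η_mlieBracket_φ (hS : S.IsSasakian)
    {X : ∀ x : M, TangentSpace I x} (hX : IsSmoothVectorField I X)
    (hη : ∀ x, S.η x (X x) = 0) (x : M) :
    S.η x (mlieBracket I X (fun y ↦ S.φ y (X y)) x) = 2 * S.g.inner x (X x) (X x) := by
  have h := hS.extDerivOneForm_eq hX (S.isSmoothVectorField_φ hX) x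
  have h1 : (fun y ↦ S.η y (S.φ y (X y))) = fun _ ↦ 0 := funext fun y ↦ S.η_φ y _
  have h2 : (fun y ↦ S.η y (X y)) = fun _ ↦ 0 := funext hη
  rw [extDerivOneForm, h1, h2, S.φ_φ, hη, zero_smul, add_zero, map_neg] at h
  simp only [mvfderiv_const, zero_apply, sub_zero, zero_sub] at h
  linarith

end AlmostContact

section Horizontal

variable {E : Type*} [NormedAddCommGroup E] [NormedSpace ℝ E]
  {H : Type*} [TopologicalSpace H] {I : ModelWithCorners ℝ E H}
  {M : Type*} [TopologicalSpace M] [ChartedSpace H M] [IsManifold I ∞ M]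
  {E' : Type*} [NormedAddCommGroup E'] [NormedSpace ℝ E']
  {H' : Type*} [TopologicalSpace H'] {J : ModelWithCorners ℝ E' H'}
  {N : Type*} [TopologicalSpace N] [ChartedSpace H' N]
  {gM : Bundle.ContMDiffRiemannianMetric I ∞ E (fun x : M ↦ TangentSpace I x)}
  {F : M → N}

theorem exists_vertical_add_horizontal [FiniteDimensional ℝ E] (x : M) (v : TangentSpace I x) :
    ∃ a ∈ vertical I J F x, ∃ b ∈ horizontal I J gM F x, a + b = v := by
  have : FiniteDimensional ℝ (TangentSpace I x) := inferInstanceAs (FiniteDimensional ℝ E)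
  let B : LinearMap.BilinForm ℝ (TangentSpace I x) :=
    ContinuousLinearMap.coeLM ℝ ∘ₗ (gM.inner x).toLinearMap
  have hB : B.IsRefl := fun a b h ↦ (gM.symm x b a).trans h
  have hd : Disjoint (vertical I J F x) (B.orthogonal (vertical I J F x)) := by
    refine Submodule.disjoint_def.2 fun a ha hb ↦ ?_
    by_contra h0
    exact (gM.pos x a h0).ne' (hb a ha)
  have hc := (LinearMap.BilinForm.isCompl_orthogonal_iff_disjoint hB).2 hd
  obtain ⟨a, ha, b, hb, hab⟩ := Submodule.mem_sup.1
    (hc.sup_eq_top.symm ▸ Submodule.mem_top : v ∈ _ ⊔ _)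
  exact ⟨a, ha, b, fun w hw ↦ (gM.symm x b w).trans (hb w hw), hab⟩

variable [IsManifold J ∞ N]
  {gN : Bundle.ContMDiffRiemannianMetric J ∞ E' (fun y : N ↦ TangentSpace J y)}

/-- Polarization on horizontal vectors; `v` may be arbitrary because both sides ignore its vertical
part. -/
theorem IsRiemannianSubmersion.inner_mfderiv_mfderiv [FiniteDimensional ℝ E]
    (hF : IsRiemannianSubmersion I J gM gN F) {x : M} {u : TangentSpace I x}
    (hu : u ∈ horizontal I J gM F x) (v : TangentSpace I x) :
    gN.inner (F x) (mfderiv I J F x u) (mfderiv I J F x v) = gM.inner x u v := by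
  obtain ⟨a, ha, b, hb, rfl⟩ := exists_vertical_add_horizontal (J := J) (gM := gM) (F := F) x v
  have h1 := hF.isometric x _ (add_mem hu hb)
  simp only [map_add, add_apply, hF.isometric x _ hu, hF.isometric x _ hb] at h1
  have h2 := gN.symm (F x) (mfderiv I J F x u) (mfderiv I J F x b)
  have h3 := gM.symm x u b
  have ha0 : mfderiv I J F x a = 0 := ha
  rw [map_add, map_add, map_add, ha0, map_zero, hu a ha]
  linarith

end Horizontal

end Sasaki

/-! ### The contradiction. -/

theorem theorem9 {m n : ℕ} (hm : 1 ≤ m)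
    {M : Type*} [TopologicalSpace M] [T2Space M] [Nonempty M]
    [ChartedSpace (EuclideanSpace ℝ (Fin (2 * m + 1))) M]
    [IsManifold (𝓡 (2 * m + 1)) ∞ M]
    {N : Type*} [TopologicalSpace N] [T2Space N]
    [ChartedSpace (EuclideanSpace ℝ (Fin n)) N]
    [IsManifold (𝓡 n) ∞ N]
    (S : Sasaki.AlmostContactMetric (𝓡 (2 * m + 1)) M) (hS : S.IsSasakian)
    (gN : Bundle.ContMDiffRiemannianMetric (𝓡 n) ∞ (EuclideanSpace ℝ (Fin n))
      (fun y : N ↦ TangentSpace (𝓡 n) y))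
    (F : M → N)
    (hF : Sasaki.IsAntiInvariantSubmersion (𝓡 (2 * m + 1)) (𝓡 n) S gN F)
    (hsum : ∀ x : M,
      Sasaki.horizontal (𝓡 (2 * m + 1)) (𝓡 n) S.g F x =
          Sasaki.phiVertical (𝓡 (2 * m + 1)) (𝓡 n) S F x ⊔ Submodule.span ℝ {S.ξ x} ∧
        Disjoint (Sasaki.phiVertical (𝓡 (2 * m + 1)) (𝓡 n) S F x)
          (Submodule.span ℝ {S.ξ x})) :
    ¬ Sasaki.IsIntegrable (𝓡 (2 * m + 1))
        (fun x : M ↦ Sasaki.horizontal (𝓡 (2 * m + 1)) (𝓡 n) S.g F x) := by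
  intro hint
  obtain ⟨p⟩ := ‹Nonempty M›
  have hξ : ∀ x, S.ξ x ∈ Sasaki.horizontal (𝓡 (2 * m + 1)) (𝓡 n) S.g F x := fun x ↦ by
    rw [(hsum x).1]
    exact Submodule.mem_sup_right (Submodule.mem_span_singleton_self _)
  obtain ⟨w, hw, hw0⟩ : ∃ w : TangentSpace (𝓡 (2 * m + 1)) p,
      mfderiv (𝓡 (2 * m + 1)) (𝓡 n) F p w = 0 ∧ w ≠ 0 := by
    by_contra! hker
    have htop : ∀ v : TangentSpace (𝓡 (2 * m + 1)) p, ∃ c : ℝ, c • S.ξ p = v := by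
      intro v
      have hv : v ∈ Sasaki.horizontal (𝓡 (2 * m + 1)) (𝓡 n) S.g F p := fun w hw ↦ by
        rw [hker w hw, map_zero]
      rw [(hsum p).1, Submodule.mem_sup] at hv
      obtain ⟨_, ⟨a, ha, rfl⟩, b, hb, hab⟩ := hv
      obtain ⟨c, rfl⟩ := Submodule.mem_span_singleton.1 hb
      refine ⟨c, ?_⟩
      have ha0 : a = 0 := hker a ha
      rw [← hab, ha0]
      simp
    have := finrank_le_one (R := ℝ) (M := EuclideanSpace ℝ (Fin (2 * m + 1))) (S.ξ p) htop
    rw [finrank_euclideanSpace_fin] at this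
    omega
  obtain ⟨W, hW, hWp, hFW⟩ := exists_smooth_vertical_vectorField hF.smooth
    (hF.surjective_mfderiv p) hw
  set Y : ∀ x : M, TangentSpace (𝓡 (2 * m + 1)) x := fun x ↦ S.φ x (W x)
  have hY : Sasaki.IsSmoothVectorField (𝓡 (2 * m + 1)) Y := S.isSmoothVectorField_φ hW
  have hYh : ∀ x, Y x ∈ Sasaki.horizontal (𝓡 (2 * m + 1)) (𝓡 n) S.g F x := fun x ↦
    hF.antiInvariant x ⟨W x, hFW x, rfl⟩
  have hηW : ∀ x, S.η x (W x) = 0 := fun x ↦ by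
    rw [S.η_eq, S.g.symm]
    exact hξ x _ (hFW x)
  have hξY : ∀ x, gN.inner (F x) (mfderiv (𝓡 (2 * m + 1)) (𝓡 n) F x (S.ξ x))
      (mfderiv (𝓡 (2 * m + 1)) (𝓡 n) F x (Y x)) = 0 := fun x ↦ by
    rw [hF.inner_mfderiv_mfderiv (hξ x), S.g.symm, ← S.η_eq]
    exact S.η_φ x _
  have hLie := inner_mfderiv_mlieBracket_add_eq_zero gN hF.smooth hW S.smooth_ξ hY hFW hξY p
  -- After rewriting, `hLie` reads `-g(φW, [ξ, W]) + 2 g(W, W) = 0` at `p`.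
  rw [gN.symm, hF.inner_mfderiv_mfderiv (hYh p), hF.inner_mfderiv_mfderiv (hξ p), S.g.symm p (S.ξ p),
    ← S.η_eq, hS.η_mlieBracket_φ hW hηW, mlieBracket_swap_apply, map_neg] at hLie
  have hzero : S.g.inner p (Y p) (mlieBracket (𝓡 (2 * m + 1)) S.ξ W p) = 0 := by
    -- Integrability enters only here, for the single pair `ξ`, `φW`.
    have h1 : S.g.inner p (mlieBracket (𝓡 (2 * m + 1)) S.ξ Y p) (W p) = 0 :=
      hint S.ξ Y S.smooth_ξ hY hξ hYh p (W p) (hFW p)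
    have h2 := congrArg (fun v ↦ S.g.inner p v (S.φ p (W p))) (hS.φ_mlieBracket_ξ hW p)
    simp only [S.g_φ_φ, hηW, mul_zero, sub_zero] at h2
    rw [h1] at h2
    rw [S.g.symm, S.inner_φ_right, h2, neg_zero]
  rw [hzero, hWp] at hLie
  have := S.g.pos p w hw0
  linarith
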